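/- Let $n,d\ge 1$ be integers. On $\mathbb Z^d$ and on $\mathbb Z^{nd}\ni \mathbf x=(x_1,\dots,x_n)$, $x_j\in\mathbb Z^d$, use the max-norm $\|\cdot\|$, and put $\langle \mathbf x\rangle=\max\{1,\|\mathbf x\|\}$. For real $L$ let $\Lambda_L(\mathbf u)=\{\mathbf x\in\mathbb Z^{nd}:\|\mathbf x-\mathbf u\|\le L\}$. **Model.** Let $r>0$ and $T(\mathbf x,\mathbf y)=\langle y_j-x_j\rangle^{-r}$ if $x_i=y_i$ for all $i\ne j$ (for some $j$), and $T(\mathbf x,\mathbf y)=0$ otherwise. Let $U:\mathbb Z^d\times\mathbb Z^d\to\mathbb R$ be symmetric, with $|U|\le M_1<\infty$ and $U(x,x')=0$ whenever $\|x-x'\|\ge r_0$, where $r_0\ge 1$; put $\mathbf U(\mathbf x)=\sum_{j_1<j_2}U(x_{j_1},x_{j_2})$. Let $V(x,\cdot)$, $x\in\mathbb Z^d$, be IID real random variables on a probability space $(\Omega,\mathcal F,\mathbb P)$ whose common law $\mu$ satisfies $\operatorname{supp}\mu\subset[-M,M]$ with $0<M<\infty$; put $\mathbf V(\mathbf x,\omega)=\sum_{j=1}^nV(x_j,\omega)$.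 For $g\neq0$ and a finite $\Lambda\subset\mathbb Z^{nd}$ let $\mathbf H_\Lambda(\omega)=\frac1g(T_\Lambda+\mathbf U_\Lambda)+\mathbf V_\Lambda(\omega)$ on $\ell^2(\Lambda)$, where the subscript $\Lambda$ denotes restriction to $\Lambda$. For $\rho>0$ define $\mathcal K_\rho(\mu)\in[0,\infty]$ by $\frac1{\mathcal K_\rho(\mu)}=\inf_{\kappa>0}\ \sup_{0<|a-b|\le\kappa}|a-b|^{-\rho}\mu([a,b])$; $\mu$ is Hölder continuous of order $\rho$ if $\mathcal K_\rho(\mu)>0$. If $0<\kappa<\mathcal K_\rho(\mu)$, then there is $\kappa_0=\kappa_0(\kappa,\mu)>0$ such that $$\mu([a,b])\le\kappa^{-1}|a-b|^\rho\quad\text{whenever } 0\le b-a\le\kappa_0.\qquad(*)$$ **Separable cubes.** For $J\subseteq\{1,\dots,n\}$ and $\Lambda\subset\mathbb Z^{nd}$ let $\Pi_J\Lambda=\{x_j: j\in J,\ \mathbf x\in\Lambda\}$ and $\Pi\Lambda=\Pi_{\{1,\dots,n\}}\Lambda$. The cubes $\Lambda_L(\mathbf u),\Lambda_L(\mathbf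 v)$ are separable if $\|\mathbf u-\mathbf v\|>11nL$ and there is a nonempty $J\subseteq\{1,\dots,n\}$ such that $\Pi_J\Lambda_{L+r_0}(\mathbf u)\cap\big(\Pi_{J^c}\Lambda_{L+r_0}(\mathbf u)\cup\Pi\Lambda_{L+r_0}(\mathbf v)\big)=\emptyset$, or the same holds with $\mathbf u$ and $\mathbf v$ exchanged. **Singular cubes.** Fix real numbers $\tau_n$, $C_0>0$ and $\frac{nd}2<s_0\le r_n<r-\frac{nd}2$. For a matrix $\mathcal M=(\mathcal M(\mathbf x,\mathbf y))_{\mathbf x\in X,\mathbf y\in Y}$ with $X,Y\subset\mathbb Z^{nd}$ finite let $$\|\mathcal M\|_s^2=C_0\sum_{\mathbf v\in X-Y}\Big(\sup_{\mathbf x-\mathbf y=\mathbf v}|\mathcal M(\mathbf x,\mathbf y)|\Big)^2\langle\mathbf v\rangle^{2s}.$$ The cube $\Lambda_L(\mathbf u)$ is $(E,\delta)$-non-singular if $(\mathbf H_{\Lambda_L(\mathbf u)}-E)^{-1}$ exists and $\|(\mathbf H_{\Lambda_L(\mathbf u)}-E)^{-1}\|_s\le L^{\tau_n+\delta s}$ for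 all $s\in[s_0,r_n]$; otherwise it is $(E,\delta)$-singular. **Theorem (initial scale estimate).** Let $\rho,\kappa,\kappa_0>0$, let $p^{(n)}>0$ and let $\tau_n>\frac{2p^{(n)}+(2n+1)d}{\rho}$. There is a constant $L_0^*>0$ depending only on $n,d,\kappa,\kappa_0,\rho,p^{(n)},\tau_n,r_n,s_0,C_0$, and for every real $L_0>L_0^*$ there is a constant $g_0^*>0$ depending only on these parameters and on $L_0$ and $M_1$, such that the following holds for every model as above for which $\kappa<\mathcal K_\rho(\mu)$ and $(*)$ holds: for all $g$ with $|g|>g_0^*$ and every pair of separable cubes $\Lambda_{L_0}(\mathbf u),\Lambda_{L_0}(\mathbf v)$, $$\mathbb P\Big\{\exists E\in\mathbb R:\ \Lambda_{L_0}(\mathbf u)\text{ and }\Lambda_{L_0}(\mathbf v)\text{ are both }\big(E,\tfrac12\big)\text{-singular}\Big\}\le L_0^{-2p^{(n)}}.$$ -/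

import Mathlib

open MeasureTheory ProbabilityTheory
open scoped Pointwise ENNReal

noncomputable section

namespace MultiParticle

/-- The lattice `ℤ^d`. Its norm is the max-norm. -/
abbrev Site (d : ℕ) : Type := Fin d → ℤ

/-- Configurations `x = (x₁, …, xₙ) ∈ ℤ^{nd}` of `n` particles. The norm is the max-norm
`‖x‖ = max_j ‖x_j‖ = max_{j,i} |x_j^{(i)}|`. -/
abbrev Config (n d : ℕ) : Type := Fin n → Site d

/-- `⟨x⟩ = max {1, ‖x‖}`. -/
def bracket {E : Type*} [Norm E] (x : E) : ℝ := max 1 ‖x‖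

/-- The `n`-particle lattice cube
`Λ_L(u) = (×_j ×_i [u_j^{(i)} - L, u_j^{(i)} + L]) ∩ ℤ^{nd}`. -/
def cube {n d : ℕ} (L : ℝ) (u : Config n d) : Finset (Config n d) :=
  Fintype.piFinset fun j => Fintype.piFinset fun i =>
    Finset.Icc ⌈(u j i : ℝ) - L⌉ ⌊(u j i : ℝ) + L⌋

theorem mem_cube {n d : ℕ} {L : ℝ} {u x : Config n d} :
    x ∈ cube L u ↔ ∀ j i, |(x j i : ℝ) - u j i| ≤ L := by
  simp only [cube, Fintype.mem_piFinset, Finset.mem_Icc, Int.ceil_le, Int.le_floor, abs_le]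
  refine forall_congr' fun j => forall_congr' fun i => ?_
  constructor <;> rintro ⟨h₁, h₂⟩ <;> constructor <;> linarith

theorem mem_cube_iff_norm {n d : ℕ} {L : ℝ} (hL : 0 ≤ L) {u x : Config n d} :
    x ∈ cube L u ↔ ‖x - u‖ ≤ L := by
  rw [mem_cube, pi_norm_le_iff_of_nonneg hL]
  refine forall_congr' fun j => ?_
  rw [pi_norm_le_iff_of_nonneg hL]
  refine forall_congr' fun i => ?_
  simp [Int.norm_eq_abs]

/-- The particle projection `Π_J Λ = ⋃_{j ∈ J} Π_j Λ ⊆ ℤ^d`. -/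
def proj {n d : ℕ} (J : Finset (Fin n)) (Λ : Finset (Config n d)) : Set (Site d) :=
  {a | ∃ j ∈ J, ∃ x ∈ Λ, x j = a}

/-- Weak separability of the cubes `Λ_L(u)` and `Λ_L(v)`, for the interaction range `r₀`. -/
def WeaklySeparable {n d : ℕ} (r₀ L : ℝ) (u v : Config n d) : Prop :=
  ∃ J : Finset (Fin n), J.Nonempty ∧
    (proj J (cube (L + r₀) u) ∩
        (proj Jᶜ (cube (L + r₀) u) ∪ proj Finset.univ (cube (L + r₀) v)) = ∅ ∨
      proj J (cube (L + r₀) v) ∩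
        (proj Jᶜ (cube (L + r₀) v) ∪ proj Finset.univ (cube (L + r₀) u)) = ∅)

/-- Separability of the cubes `Λ_L(u)` and `Λ_L(v)`, for the interaction range `r₀`. -/
def Separable {n d : ℕ} (r₀ L : ℝ) (u v : Config n d) : Prop :=
  WeaklySeparable r₀ L u v ∧ 11 * (n : ℝ) * L < ‖u - v‖

open Classical in
/-- The power-law long-range hopping: `T(x, y) = ⟨y_j - x_j⟩^{-r}` if `x_i = y_i` for all `i ≠ j`
(for some `j`), and `T(x, y) = 0` otherwise. In the first case `‖y - x‖ = ‖y_j - x_j‖`, see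
`hopping_eq`. -/
def hopping {n d : ℕ} (r : ℝ) (x y : Config n d) : ℝ :=
  if ∃ j, ∀ i, i ≠ j → x i = y i then (bracket (y - x) ^ r)⁻¹ else 0

theorem hopping_eq {n d : ℕ} (r : ℝ) (x y : Config n d) (j : Fin n)
    (h : ∀ i, i ≠ j → x i = y i) : hopping r x y = 1 / bracket (y j - x j) ^ r := by
  have hnorm : ‖y - x‖ = ‖y j - x j‖ := by
    apply le_antisymm
    · rw [pi_norm_le_iff_of_nonneg (norm_nonneg _)]
      intro i
      by_cases hi : i = j
      · subst hi; simp
      · simp [h i hi]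
    · exact norm_le_pi_norm (y - x) j
  rw [hopping, if_pos ⟨j, h⟩, bracket, bracket, hnorm, one_div]

/-- The interaction energy `U(x) = ∑_{j₁ < j₂} U(x_{j₁}, x_{j₂})`. -/
def interaction {n d : ℕ} (U : Site d → Site d → ℝ) (x : Config n d) : ℝ :=
  ∑ q : Fin n × Fin n with q.1 < q.2, U (x q.1) (x q.2)

/-- The external potential energy `V(x) = ∑_j V(x_j)` of a configuration. -/
def external {n d : ℕ} (V : Site d → ℝ) (x : Config n d) : ℝ := ∑ j, V (x j)

/-- The finite-volume Hamiltonian `H_Λ = g⁻¹ (T_Λ + U_Λ) + V_Λ`, for one realization `V` of the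
potential, as a matrix over the points of `Λ`. -/
def hamiltonian {n d : ℕ} (r g : ℝ) (U : Site d → Site d → ℝ) (V : Site d → ℝ)
    (Λ : Finset (Config n d)) : Matrix Λ Λ ℂ :=
  ((1 / g : ℝ) : ℂ) •
      (Matrix.of (fun x y : Λ => (hopping r (x : Config n d) y : ℂ)) +
        Matrix.diagonal (fun x : Λ => (interaction U (x : Config n d) : ℂ))) +
    Matrix.diagonal (fun x : Λ => (external V (x : Config n d) : ℂ))

/-- The Sobolev norm of a matrix, with normalizing constant `C₀`:
`‖M‖_s² = C₀ ∑_{v ∈ X - Y} (sup_{x - y = v} |M(x, y)|)² ⟨v⟩^{2s}`. -/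
def sobolevNorm {n d : ℕ} (C₀ s : ℝ) {X Y : Finset (Config n d)} (A : Matrix X Y ℂ) : ℝ :=
  Real.sqrt (C₀ * ∑ v ∈ X - Y,
    (⨆ q : {q : X × Y // (q.1 : Config n d) - (q.2 : Config n d) = v}, ‖A q.1.1 q.1.2‖) ^ 2 *
      bracket v ^ (2 * s))

/-- `Λ_L(u)` is `(E, δ)`-non-singular: the Green's function `(H_{Λ_L(u)} - E)⁻¹` exists and
`‖(H_{Λ_L(u)} - E)⁻¹‖_s ≤ L^{τ + δ s}` for all `s ∈ [s₀, rₙ]`. -/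
def NonSingular {n d : ℕ} (C₀ s₀ rₙ τ r g : ℝ) (U : Site d → Site d → ℝ) (V : Site d → ℝ)
    (E δ L : ℝ) (u : Config n d) : Prop :=
  IsUnit (hamiltonian r g U V (cube L u) - (E : ℂ) • 1) ∧
    ∀ s ∈ Set.Icc s₀ rₙ,
      sobolevNorm C₀ s (hamiltonian r g U V (cube L u) - (E : ℂ) • 1)⁻¹ ≤ L ^ (τ + δ * s)

/-- `Λ_L(u)` is `(E, δ)`-singular. -/
def Singular {n d : ℕ} (C₀ s₀ rₙ τ r g : ℝ) (U : Site d → Site d → ℝ) (V : Site d → ℝ)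
    (E δ L : ℝ) (u : Config n d) : Prop :=
  ¬ NonSingular C₀ s₀ rₙ τ r g U V E δ L u

/-- The assumptions on the two-body interaction: symmetric, bounded by `M₁`, of range `r₀`. -/
structure IsInteraction {d : ℕ} (U : Site d → Site d → ℝ) (M₁ r₀ : ℝ) : Prop where
  bounded : ∀ x y, |U x y| ≤ M₁
  symm : ∀ x y, U x y = U y x
  range : ∀ x y, r₀ ≤ ‖x - y‖ → U x y = 0

/-- `V(x, ω)`, `x ∈ ℤ^d`, are IID real random variables with common distribution `μ`. -/
structure IsIIDPotential {d : ℕ} {Ω : Type*} [MeasurableSpace Ω] (P : Measure Ω)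
    (V : Site d → Ω → ℝ) (μ : Measure ℝ) : Prop where
  measurable : ∀ x, Measurable (V x)
  indep : iIndepFun V P
  law : ∀ x, P.map (V x) = μ

/-- `K_ρ(μ) ∈ [0, ∞]`, given by
`1 / K_ρ(μ) = inf_{κ > 0} sup_{0 < |a - b| ≤ κ} |a - b|^{-ρ} μ([a, b])`.
The measure `μ` is Hölder continuous of order `ρ` iff `K_ρ(μ) > 0`. -/
def holderK (ρ : ℝ) (μ : Measure ℝ) : ℝ≥0∞ :=
  (⨅ (κ : ℝ) (_ : 0 < κ), ⨆ (a : ℝ) (b : ℝ) (_ : 0 < |a - b| ∧ |a - b| ≤ κ),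
    ENNReal.ofReal (|a - b| ^ (-ρ)) * μ (Set.Icc a b))⁻¹

/-- `μ([a, b]) ≤ κ⁻¹ |a - b|^ρ` for all intervals of length at most `κ₀`. -/
def HolderUpTo (ρ κ κ₀ : ℝ) (μ : Measure ℝ) : Prop :=
  ∀ a b : ℝ, 0 ≤ b - a → b - a ≤ κ₀ → μ (Set.Icc a b) ≤ ENNReal.ofReal (κ⁻¹ * |a - b| ^ ρ)

/-- If `0 < κ < K_ρ(μ)` then `κ₀` as in `HolderUpTo` exists, with a value depending on `μ`. -/
theorem exists_holderUpTo {ρ κ : ℝ} (hρ : 0 < ρ) (hκ : 0 < κ) {μ : Measure ℝ}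
    (h : ENNReal.ofReal κ < holderK ρ μ) : ∃ κ₀ : ℝ, 0 < κ₀ ∧ HolderUpTo ρ κ κ₀ μ := by
  rw [holderK, ENNReal.lt_inv_iff_lt_inv] at h
  simp only [iInf_lt_iff] at h
  obtain ⟨δ, hδ, h⟩ := h
  have key : ∀ a b : ℝ, 0 < b - a → b - a ≤ δ →
      μ (Set.Icc a b) ≤ ENNReal.ofReal (κ⁻¹ * |a - b| ^ ρ) := by
    intro a b h0 h1
    have hab : |a - b| = b - a := by rw [abs_sub_comm]; exact abs_of_pos h0
    have hle : ENNReal.ofReal ((b - a) ^ (-ρ)) * μ (Set.Icc a b) ≤ (ENNReal.ofReal κ)⁻¹ := by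
      refine le_trans ?_ h.le
      have h2 : 0 < |a - b| ∧ |a - b| ≤ δ := by rw [hab]; exact ⟨h0, h1⟩
      have h3 := le_iSup₂_of_le (f := fun a b : ℝ => ⨆ (_ : 0 < |a - b| ∧ |a - b| ≤ δ),
        ENNReal.ofReal (|a - b| ^ (-ρ)) * μ (Set.Icc a b)) a b
        (le_iSup_of_le h2 (le_refl _))
      rwa [hab] at h3
    have hpos : 0 < (b - a) ^ ρ := Real.rpow_pos_of_pos h0 ρ
    have h4 := mul_le_mul_right hle (ENNReal.ofReal ((b - a) ^ ρ))
    rw [← mul_assoc, ← ENNReal.ofReal_mul hpos.le, ← Real.rpow_add h0, add_neg_cancel,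
      Real.rpow_zero, ENNReal.ofReal_one, one_mul, ← ENNReal.ofReal_inv_of_pos hκ,
      ← ENNReal.ofReal_mul hpos.le] at h4
    rwa [hab, mul_comm]
  refine ⟨δ, hδ, fun a b h0 h1 => ?_⟩
  rcases h0.lt_or_eq with h0 | h0
  · exact key a b h0 h1
  · have hab : b = a := by linarith
    subst hab
    have hlim : Filter.Tendsto (fun t : ℝ => ENNReal.ofReal (κ⁻¹ * t ^ ρ))
        (nhdsWithin 0 (Set.Ioi 0)) (nhds (ENNReal.ofReal (κ⁻¹ * (0 : ℝ) ^ ρ))) := by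
      refine Filter.Tendsto.mono_left ?_ nhdsWithin_le_nhds
      exact (ENNReal.continuous_ofReal.tendsto _).comp
        (((Real.continuousAt_rpow_const 0 ρ (Or.inr hρ.le)).tendsto).const_mul κ⁻¹)
    rw [sub_self, abs_zero]
    refine ge_of_tendsto hlim ?_
    filter_upwards [Ioc_mem_nhdsGT hδ] with t ht
    have h5 := key b (b + t) (by simpa using ht.1) (by simpa using ht.2)
    have h6 : |b - (b + t)| = t := by rw [sub_add_cancel_left, abs_neg, abs_of_pos ht.1]
    rw [h6] at h5
    exact le_trans (measure_mono (Set.Icc_subset_Icc_right (by linarith [ht.1]))) h5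

end MultiParticle

end

open MultiParticle

/-! For large `|g|` the operator `H_Λ - E` is a diagonal matrix plus hopping entries of size at most
`1/|g|`. If all diagonal entries stay at least `L^(-τ)` away from zero, diagonal dominance bounds
the inverse by `2 L^τ` on the diagonal and by `O(1/|g|)` off it, so the cube is non-singular
(`nonSingular_of_le_abs`). Hence two cubes singular at a common `E` contain points `x`, `y` whose
diagonal energies are both within `L^(-τ)` of `E`, so within `2 L^(-τ)` of each other; `E` is
eliminated.

For fixed `x`, `y`, separability provides a site occupied by one configuration and not by the other.
The potential there enters the energy difference with a nonzero integer coefficient and is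
independent of the rest, so Hölder continuity of `μ` bounds the probability by `κ⁻¹ (4 L^(-τ))^ρ`
(`measure_external_sub_lt_le`). A union bound over at most `(2L+1)^(2nd)` pairs and the lower bound
on `τ` finish the proof. -/

namespace MultiParticle

/-! ### Concentration of energy differences -/

/-- If `X` and `Y` are independent and every interval of length `2η` has measure at most `q` for the
law of `X`, then so does every such interval for the law of `k X + Y`, when `1 ≤ |k|`. -/
theorem measure_abs_mul_add_lt_le {Ω : Type*} [MeasurableSpace Ω] {P : Measure Ω}
    [IsProbabilityMeasure P] {X Y : Ω → ℝ} (hX : Measurable X) (hY : Measurable Y) {k : ℝ}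
    (hk : 1 ≤ |k|) (hXY : IndepFun Y (fun ω => k * X ω) P) {q : ℝ≥0∞} {η : ℝ}
    (hq : ∀ a : ℝ, P.map X (Set.Icc (a - η) (a + η)) ≤ q) (c : ℝ) :
    P {ω | |k * X ω + Y ω + c| < η} ≤ q := by
  have hk0 : k ≠ 0 := by
    rintro rfl
    simp at hk
    linarith
  have hkX : Measurable fun ω => k * X ω := hX.const_mul k
  have hS : MeasurableSet {z : ℝ × ℝ | |z.2 + z.1 + c| < η} :=
    measurableSet_lt (by fun_prop) measurable_const
  have hmap : P {ω | |k * X ω + Y ω + c| < η} =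
      P.map (fun ω => (Y ω, k * X ω)) {z : ℝ × ℝ | |z.2 + z.1 + c| < η} := by
    rw [Measure.map_apply (hY.prodMk hkX) hS]
    rfl
  have : IsProbabilityMeasure (P.map Y) := Measure.isProbabilityMeasure_map hY.aemeasurable
  have : IsProbabilityMeasure (P.map fun ω => k * X ω) :=
    Measure.isProbabilityMeasure_map hkX.aemeasurable
  rw [hmap, (indepFun_iff_map_prod_eq_prod_map_map hY.aemeasurable hkX.aemeasurable).1 hXY,
    Measure.prod_apply hS]
  -- Fubini: for `Y = w` fixed, `X` is confined to an interval of half-length `η / |k| ≤ η` about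
  -- `-(w + c) / k`.
  calc ∫⁻ w, (P.map fun ω => k * X ω) (Prod.mk w ⁻¹' {z : ℝ × ℝ | |z.2 + z.1 + c| < η}) ∂(P.map Y)
      ≤ ∫⁻ _, q ∂(P.map Y) := by
        refine lintegral_mono fun w => ?_
        refine le_trans ?_ (hq (-(w + c) / k))
        rw [Measure.map_apply hkX (measurable_prodMk_left hS),
          Measure.map_apply hX measurableSet_Icc]
        refine measure_mono fun ω hω => ?_
        have h1 : |k * X ω + w + c| < η := hω
        have h2 : k * X ω + w + c = k * (X ω - -(w + c) / k) := by field_simp; ring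
        rw [h2, abs_mul] at h1
        have h3 : |X ω - -(w + c) / k| ≤ η :=
          (le_mul_of_one_le_left (abs_nonneg _) hk).trans h1.le
        rw [abs_le] at h3
        exact ⟨by linarith [h3.1], by linarith [h3.2]⟩
    _ = q := by simp

-- Occupation numbers turn the energy into a combination of independent variables indexed by
-- distinct sites.
open Classical in
theorem external_eq_sum_card {n d : ℕ} (V : Site d → ℝ) (x : Config n d) {S : Finset (Site d)}
    (hS : ∀ j, x j ∈ S) :
    external V x = ∑ b ∈ S, (Finset.card {j | x j = b} : ℝ) * V b := by
  rw [external, ← Finset.sum_fiberwise_of_maps_to (s := Finset.univ) (t := S) (g := x)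
    (fun j _ => hS j)]
  refine Finset.sum_congr rfl fun b _ => ?_
  rw [← nsmul_eq_mul]
  refine Finset.sum_eq_card_nsmul fun j hj => ?_
  rw [(Finset.mem_filter.1 hj).2]

/-- Concentration bound for the difference of the potential energies of two configurations, one of
which has a particle at a site that the other does not occupy. -/
theorem measure_external_sub_lt_le {n d : ℕ} {Ω : Type*} [MeasurableSpace Ω] {P : Measure Ω}
    [IsProbabilityMeasure P] {V : Site d → Ω → ℝ} {μ : Measure ℝ} (hV : IsIIDPotential P V μ)
    {q : ℝ≥0∞} {η : ℝ} (hq : ∀ a : ℝ, μ (Set.Icc (a - η) (a + η)) ≤ q)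
    {x y : Config n d} {j₀ : Fin n} (hy : ∀ j, y j ≠ x j₀) (c : ℝ) :
    P {ω | |external (fun a => V a ω) x - external (fun a => V a ω) y + c| < η} ≤ q := by
  classical
  set S : Finset (Site d) := Finset.univ.image x ∪ Finset.univ.image y with hSdef
  have hxS : ∀ j, x j ∈ S := fun j => by simp [hSdef]
  have hyS : ∀ j, y j ∈ S := fun j => by simp [hSdef]
  set k : Site d → ℝ := fun b =>
    (Finset.card {j | x j = b} : ℝ) - (Finset.card {j | y j = b} : ℝ) with hkdef
  set f : Site d → Ω → ℝ := fun b ω => k b * V b ω with hf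
  have hfm : ∀ b, Measurable (f b) := fun b => (hV.measurable b).const_mul _
  have hfi : iIndepFun f P :=
    hV.indep.comp (fun b t => k b * t) fun b => measurable_const_mul _
  -- At this site `y` contributes nothing, so the coefficient is the occupation number of `x`, a
  -- positive integer.
  have hk : 1 ≤ |k (x j₀)| := by
    have h0 : Finset.card {j | y j = x j₀} = 0 := by
      simp [hy]
    have h1 : 1 ≤ Finset.card {j | x j = x j₀} :=
      Finset.card_pos.2 ⟨j₀, by simp⟩
    have h2 : (1 : ℝ) ≤ (Finset.card {j | x j = x j₀} : ℝ) := by exact_mod_cast h1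
    simp only [hkdef, h0, Nat.cast_zero, sub_zero]
    exact h2.trans (le_abs_self _)
  have hind := hfi.indepFun_finsetSum_of_notMem hfm (s := S.erase (x j₀)) (i := x j₀)
    (Finset.notMem_erase _ _)
  have hsum : ∀ ω, external (fun a => V a ω) x - external (fun a => V a ω) y =
      k (x j₀) * V (x j₀) ω + (∑ b ∈ S.erase (x j₀), f b) ω := by
    intro ω
    rw [external_eq_sum_card _ x hxS, external_eq_sum_card _ y hyS, ← Finset.sum_sub_distrib,
      Finset.sum_apply, ← Finset.add_sum_erase S _ (hxS j₀)]
    simp only [hf, hkdef, sub_mul]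
  simp only [hsum]
  have hW : Measurable (∑ b ∈ S.erase (x j₀), f b) := by
    rw [Finset.sum_fn]
    exact Finset.measurable_sum _ fun b _ => hfm b
  have hq' : ∀ a : ℝ, P.map (V (x j₀)) (Set.Icc (a - η) (a + η)) ≤ q := by
    rw [hV.law]
    exact hq
  exact measure_abs_mul_add_lt_le (hV.measurable _) hW hk hind hq' c

/-! ### Geometry of cubes -/

/-- Points of weakly separable cubes: one of the two has a particle at a site that the other one
does not occupy. -/
theorem WeaklySeparable.exists_ne {n d : ℕ} {r₀ L : ℝ} {u v : Config n d} (hr₀ : 0 ≤ r₀)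
    (h : WeaklySeparable r₀ L u v) {x y : Config n d} (hx : x ∈ cube L u) (hy : y ∈ cube L v) :
    (∃ j₀, ∀ j, y j ≠ x j₀) ∨ ∃ j₀, ∀ j, x j ≠ y j₀ := by
  have hmono : ∀ {w z : Config n d}, z ∈ cube L w → z ∈ cube (L + r₀) w := fun hz =>
    mem_cube.2 fun j i => (mem_cube.1 hz j i).trans (by linarith)
  obtain ⟨J, ⟨j₀, hj₀⟩, h | h⟩ := h
  · exact .inl ⟨j₀, fun j hj => Set.eq_empty_iff_forall_notMem.1 h (x j₀)
      ⟨⟨j₀, hj₀, x, hmono hx, rfl⟩, .inr ⟨j, Finset.mem_univ _, y, hmono hy, hj⟩⟩⟩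
  · exact .inr ⟨j₀, fun j hj => Set.eq_empty_iff_forall_notMem.1 h (y j₀)
      ⟨⟨j₀, hj₀, y, hmono hy, rfl⟩, .inr ⟨j, Finset.mem_univ _, x, hmono hx, hj⟩⟩⟩

theorem card_cube_le {n d : ℕ} {L : ℝ} (hL : 0 ≤ L) (u : Config n d) :
    ((cube L u).card : ℝ) ≤ (2 * L + 1) ^ (n * d) := by
  have h1 : ∀ j i, ((Finset.Icc ⌈(u j i : ℝ) - L⌉ ⌊(u j i : ℝ) + L⌋).card : ℝ) ≤ 2 * L + 1 := by
    intro j i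
    have e1 : ⌈(u j i : ℝ) - L⌉ = u j i - ⌊L⌋ := by
      rw [sub_eq_add_neg, Int.ceil_intCast_add, Int.ceil_neg, sub_eq_add_neg]
    have e2 : ⌊(u j i : ℝ) + L⌋ = u j i + ⌊L⌋ := Int.floor_intCast_add _ _
    have h0 : 0 ≤ ⌊L⌋ := Int.floor_nonneg.2 hL
    have h3 : ((u j i + ⌊L⌋ + 1 - (u j i - ⌊L⌋)).toNat : ℤ) = 2 * ⌊L⌋ + 1 := by
      rw [Int.toNat_of_nonneg (by linarith)]; ring
    rw [e1, e2, Int.card_Icc, ← Int.cast_natCast, h3]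
    push_cast
    linarith [Int.floor_le L]
  rw [cube, Fintype.card_piFinset, Nat.cast_prod]
  calc _ ≤ ∏ _j : Fin n, (2 * L + 1) ^ d := by
        refine Finset.prod_le_prod (fun _ _ => Nat.cast_nonneg _) fun j _ => ?_
        rw [Fintype.card_piFinset, Nat.cast_prod]
        refine (Finset.prod_le_prod (fun _ _ => Nat.cast_nonneg _) fun i _ => h1 j i).trans ?_
        simp
    _ = _ := by simp [← pow_mul, mul_comm]

/-! ### Inverses of diagonally dominant matrices -/

section Matrix
variable {ι : Type*} [Fintype ι] [DecidableEq ι] {D : ι → ℂ} {B : Matrix ι ι ℂ} {η ε : ℝ}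

/-- A small perturbation of a diagonal matrix that is bounded below is bounded below in the
supremum norm. -/
theorem norm_le_of_diagonal_add_mulVec (hη : 0 < η) (hD : ∀ i, η ≤ ‖D i‖) (hB : ∀ i j, ‖B i j‖ ≤ ε)
    (hε : ε * Fintype.card ι ≤ η / 2) {v : ι → ℂ} {β : ℝ}
    (hv : ∀ i, ‖((Matrix.diagonal D + B).mulVec v) i‖ ≤ β) (i : ι) : ‖v i‖ ≤ 2 * β / η := by
  -- In the row where `‖v k‖` is maximal, the perturbation costs at most `η / 2 * ‖v k‖`, which half
  -- of the diagonal term absorbs.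
  obtain ⟨k, -, hk⟩ := Finset.exists_max_image Finset.univ (fun j => ‖v j‖) ⟨i, Finset.mem_univ i⟩
  refine (hk i (Finset.mem_univ _)).trans ?_
  have h1 : (Matrix.diagonal D + B).mulVec v k = D k * v k + ∑ j, B k j * v j := by
    rw [Matrix.add_mulVec, Pi.add_apply, Matrix.mulVec_diagonal]
    rfl
  have h2 : ‖∑ j, B k j * v j‖ ≤ ε * Fintype.card ι * ‖v k‖ := by
    refine (norm_sum_le _ _).trans ?_
    refine (Finset.sum_le_card_nsmul _ _ (ε * ‖v k‖) fun j hj => ?_).trans ?_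
    · rw [norm_mul]
      exact mul_le_mul (hB k j) (hk j hj) (norm_nonneg _) ((norm_nonneg _).trans (hB k j))
    · rw [nsmul_eq_mul, Finset.card_univ]
      exact le_of_eq (by ring)
  have h3 : ‖D k * v k‖ ≤ β + ε * Fintype.card ι * ‖v k‖ := by
    have h4 : D k * v k = (Matrix.diagonal D + B).mulVec v k - ∑ j, B k j * v j := by
      rw [h1]; ring
    rw [h4]
    exact (norm_sub_le _ _).trans (add_le_add (hv k) h2)
  rw [norm_mul] at h3
  have h5 := mul_le_mul_of_nonneg_right (hD k) (norm_nonneg (v k))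
  have h6 := mul_le_mul_of_nonneg_right hε (norm_nonneg (v k))
  rw [le_div_iff₀ hη]
  linarith

theorem isUnit_diagonal_add (hη : 0 < η) (hD : ∀ i, η ≤ ‖D i‖) (hB : ∀ i j, ‖B i j‖ ≤ ε)
    (hε : ε * Fintype.card ι ≤ η / 2) : IsUnit (Matrix.diagonal D + B) := by
  rw [Matrix.isUnit_iff_isUnit_det, isUnit_iff_ne_zero]
  intro h
  obtain ⟨v, hv0, hv⟩ := Matrix.exists_mulVec_eq_zero_iff.2 h
  refine hv0 (funext fun i => norm_le_zero_iff.1 ?_)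
  have := norm_le_of_diagonal_add_mulVec hη hD hB hε (v := v) (β := 0) (by simp [hv]) i
  simpa using this

/-- Column `j` of the inverse solves the linear system with a unit vector on the right, so the lower
bound applies with `β = 1`. -/
theorem norm_diagonal_add_inv_le (hη : 0 < η) (hD : ∀ i, η ≤ ‖D i‖) (hB : ∀ i j, ‖B i j‖ ≤ ε)
    (hε : ε * Fintype.card ι ≤ η / 2) (i j : ι) :
    ‖(Matrix.diagonal D + B)⁻¹ i j‖ ≤ 2 / η := by
  have hU := (Matrix.isUnit_iff_isUnit_det _).1 (isUnit_diagonal_add hη hD hB hε)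
  have h := norm_le_of_diagonal_add_mulVec hη hD hB hε (β := 1)
    (v := fun k => (Matrix.diagonal D + B)⁻¹ k j) (fun k => ?_) i
  · simpa using h
  · have h1 : (Matrix.diagonal D + B).mulVec (fun k => (Matrix.diagonal D + B)⁻¹ k j) k
        = (1 : Matrix ι ι ℂ) k j := by
      rw [← Matrix.mul_nonsing_inv _ hU]; rfl
    rw [h1, Matrix.one_apply]
    split_ifs <;> simp

/-- The off-diagonal entry of `(D + B) G = 1` reads `D i * G i j = -∑ k, B i k * G k j`, which gains
a factor `ε` over the general bound on `G`. -/
theorem norm_diagonal_add_inv_le_of_ne (hη : 0 < η) (hD : ∀ i, η ≤ ‖D i‖)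
    (hB : ∀ i j, ‖B i j‖ ≤ ε) (hε : ε * Fintype.card ι ≤ η / 2) {i j : ι} (hij : i ≠ j) :
    ‖(Matrix.diagonal D + B)⁻¹ i j‖ ≤ ε * Fintype.card ι * 2 / η ^ 2 := by
  have hU := (Matrix.isUnit_iff_isUnit_det _).1 (isUnit_diagonal_add hη hD hB hε)
  set G := (Matrix.diagonal D + B)⁻¹ with hG
  have h1 : D i * G i j = -∑ k, B i k * G k j := by
    have h := congrFun (congrFun (Matrix.mul_nonsing_inv _ hU) i) j
    rw [← hG, Matrix.add_mul, Matrix.add_apply, Matrix.diagonal_mul, Matrix.one_apply_ne hij,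
      Matrix.mul_apply] at h
    exact eq_neg_of_add_eq_zero_left h
  have h2 : ‖∑ k, B i k * G k j‖ ≤ ε * Fintype.card ι * (2 / η) := by
    refine (norm_sum_le _ _).trans ?_
    refine (Finset.sum_le_card_nsmul _ _ (ε * (2 / η)) fun k _ => ?_).trans ?_
    · rw [norm_mul]
      exact mul_le_mul (hB i k) (norm_diagonal_add_inv_le hη hD hB hε k j) (norm_nonneg _)
        ((norm_nonneg _).trans (hB i k))
    · rw [nsmul_eq_mul, Finset.card_univ]
      exact le_of_eq (by ring)
  have h3 : η * ‖G i j‖ ≤ ε * Fintype.card ι * (2 / η) := by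
    refine (mul_le_mul_of_nonneg_right (hD i) (norm_nonneg _)).trans ?_
    rw [← norm_mul, h1, norm_neg]
    exact h2
  have h4 : ε * Fintype.card ι * 2 / η ^ 2 = ε * Fintype.card ι * (2 / η) / η := by
    field_simp
  rw [h4, le_div_iff₀ hη, mul_comm]
  exact h3
end Matrix

/-! ### Sobolev norm of the Green's function -/

theorem one_le_bracket {E : Type*} [Norm E] (x : E) : 1 ≤ bracket x := le_max_left _ _

theorem bracket_zero {E : Type*} [SeminormedAddGroup E] : bracket (0 : E) = 1 := by
  simp [bracket]

/-- Diagonal entries enter only at `v = 0`, where the weight is 1, so the growing weights `b ^ s`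
multiply only the small off-diagonal bound `z`. -/
theorem sobolevNorm_le {n d : ℕ} {C₀ s a z b : ℝ} (hC₀ : 0 ≤ C₀) (hs : 0 ≤ s) (ha : 0 ≤ a)
    (hz : 0 ≤ z) {X : Finset (Config n d)} (A : Matrix X X ℂ)
    (hb : ∀ v ∈ X - X, bracket v ≤ b) (hdiag : ∀ x, ‖A x x‖ ≤ a)
    (hoff : ∀ x y, x ≠ y → ‖A x y‖ ≤ z) :
    sobolevNorm C₀ s A ≤ √(C₀ * (a ^ 2 + ((X.card : ℝ) * z * b ^ s) ^ 2)) := by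
  refine Real.sqrt_le_sqrt (mul_le_mul_of_nonneg_left ?_ hC₀)
  have hterm : ∀ v ∈ X - X,
      (⨆ q : {q : X × X // (q.1 : Config n d) - (q.2 : Config n d) = v}, ‖A q.1.1 q.1.2‖) ^ 2 *
        bracket v ^ (2 * s) ≤ (if v = 0 then a ^ 2 else 0) + (z * b ^ s) ^ 2 := by
    intro v hv
    have hsup : 0 ≤ ⨆ q : {q : X × X // (q.1 : Config n d) - (q.2 : Config n d) = v},
        ‖A q.1.1 q.1.2‖ := Real.iSup_nonneg fun _ => norm_nonneg _
    by_cases h0 : v = 0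
    · subst h0
      rw [if_pos rfl, bracket_zero, Real.one_rpow, mul_one]
      refine (pow_le_pow_left₀ hsup (Real.iSup_le (fun q => ?_) ha) 2).trans
        (le_add_of_nonneg_right (sq_nonneg _))
      have : q.1.1 = q.1.2 := Subtype.ext (sub_eq_zero.1 q.2)
      rw [this]
      exact hdiag _
    · rw [if_neg h0, zero_add, mul_pow]
      have h1 := one_le_bracket v
      have h2 : bracket v ^ (2 * s) ≤ (b ^ s) ^ 2 := by
        rw [mul_comm, Real.rpow_mul (by linarith), Real.rpow_two]
        exact pow_le_pow_left₀ (by positivity)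
          (Real.rpow_le_rpow (by linarith) (hb v hv) hs) 2
      refine mul_le_mul (pow_le_pow_left₀ hsup (Real.iSup_le (fun q => ?_) hz) 2) h2
        (by positivity) (sq_nonneg _)
      refine hoff _ _ fun h => h0 ?_
      rw [← q.2, h, sub_self]
  refine (Finset.sum_le_sum hterm).trans ?_
  rw [Finset.sum_add_distrib, Finset.sum_const, nsmul_eq_mul]
  refine add_le_add ?_ ?_
  · rw [Finset.sum_ite_eq']
    split_ifs
    · exact le_rfl
    · positivity
  · have hcard : ((X - X).card : ℝ) ≤ (X.card : ℝ) ^ 2 := by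
      rw [sq]
      exact_mod_cast Finset.card_sub_le
    rw [mul_assoc, mul_pow (X.card : ℝ)]
    exact mul_le_mul_of_nonneg_right hcard (sq_nonneg _)

theorem hopping_nonneg {n d : ℕ} (r : ℝ) (x y : Config n d) : 0 ≤ hopping r x y := by
  have := one_le_bracket (y - x)
  rw [hopping]
  split_ifs <;> positivity

theorem hopping_le_one {n d : ℕ} {r : ℝ} (hr : 0 ≤ r) (x y : Config n d) : hopping r x y ≤ 1 := by
  rw [hopping]
  split_ifs
  · exact inv_le_one_of_one_le₀ (Real.one_le_rpow (one_le_bracket _) hr)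
  · exact zero_le_one

theorem bracket_le_of_mem_cube_sub {n d : ℕ} {L : ℝ} (hL : 1 ≤ L) {u v : Config n d}
    (hv : v ∈ cube L u - cube L u) : bracket v ≤ 2 * L := by
  obtain ⟨x, hx, y, hy, rfl⟩ := Finset.mem_sub.1 hv
  rw [mem_cube_iff_norm (by linarith)] at hx hy
  refine max_le (by linarith) ?_
  have h := norm_sub_le (x - u) (y - u)
  rw [sub_sub_sub_cancel_right] at h
  linarith

/-- For large coupling, a cube on which the potential energy stays away from `E` is
non-singular. -/
theorem nonSingular_of_le_abs {n d : ℕ} {C₀ s₀ rₙ τ r g E L : ℝ} {U : Site d → Site d → ℝ}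
    {V : Site d → ℝ} {u : Config n d} (hC₀ : 0 < C₀) (hs₀ : 0 ≤ s₀) (hrₙ : 0 ≤ rₙ) (hτ : 0 ≤ τ)
    (hr : 0 ≤ r) (hL : 1 ≤ L) (hLC : 5 * C₀ ≤ L ^ s₀)
    (hg : 2 * ((2 * L + 1) ^ (n * d)) ^ 2 * L ^ τ * (2 * L) ^ rₙ < |g|)
    (hE : ∀ x ∈ cube L u, L ^ (-τ) ≤ |1 / g * interaction U x + external V x - E|) :
    NonSingular C₀ s₀ rₙ τ r g U V E (1 / 2) L u := by
  have hL0 : 0 < L := by linarith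
  set N : ℝ := (2 * L + 1) ^ (n * d) with hN
  have hN1 : 1 ≤ N := one_le_pow₀ (by linarith)
  set D : cube L u → ℂ := fun x =>
    ((1 / g * interaction U (x : Config n d) + external V (x : Config n d) - E : ℝ) : ℂ) with hDd
  set B : Matrix (cube L u) (cube L u) ℂ :=
    Matrix.of fun x y => ((1 / g * hopping r (x : Config n d) y : ℝ) : ℂ) with hBd
  -- The interaction joins the diagonal part; only the hopping is treated as a perturbation.
  have hH : hamiltonian r g U V (cube L u) - (E : ℂ) • 1 = Matrix.diagonal D + B := by
    ext x y
    by_cases hxy : x = y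
    · subst hxy
      simp only [hamiltonian, hDd, hBd, Matrix.sub_apply, Matrix.add_apply, Matrix.smul_apply,
        Matrix.of_apply, Matrix.diagonal_apply_eq, Matrix.one_apply_eq, smul_eq_mul]
      push_cast
      ring
    · simp only [hamiltonian, hBd, Matrix.sub_apply, Matrix.add_apply, Matrix.smul_apply,
        Matrix.of_apply, Matrix.diagonal_apply_ne _ hxy, Matrix.one_apply_ne hxy, smul_eq_mul]
      push_cast
      ring
  have hτ1 : 1 ≤ L ^ τ := Real.one_le_rpow hL hτ
  have hb1 : 1 ≤ (2 * L) ^ rₙ := Real.one_le_rpow (by linarith) hrₙ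
  have hg0 : 0 < |g| := lt_of_le_of_lt (by positivity) hg
  have hη : 0 < L ^ (-τ) := Real.rpow_pos_of_pos hL0 _
  have hηinv : L ^ (-τ) = (L ^ τ)⁻¹ := Real.rpow_neg hL0.le _
  have hD : ∀ x, L ^ (-τ) ≤ ‖D x‖ := fun x => by
    rw [hDd, Complex.norm_real]
    exact hE x x.2
  have hB : ∀ x y, ‖B x y‖ ≤ 1 / |g| := fun x y => by
    rw [hBd, Matrix.of_apply, Complex.norm_real, Real.norm_eq_abs, abs_mul, abs_div, abs_one,
      abs_of_nonneg (hopping_nonneg _ _ _)]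
    exact mul_le_of_le_one_right (by positivity) (hopping_le_one hr _ _)
  have hcard : (Fintype.card (cube L u) : ℝ) ≤ N := by
    rw [Fintype.card_coe]
    exact card_cube_le hL0.le u
  have hε : 1 / |g| * Fintype.card (cube L u) ≤ L ^ (-τ) / 2 := by
    rw [hηinv, one_div_mul_eq_div, div_le_div_iff₀ hg0 two_pos, ← div_eq_inv_mul,
      le_div_iff₀ (by positivity)]
    refine le_trans ?_ hg.le
    calc (Fintype.card (cube L u) : ℝ) * 2 * L ^ τ ≤ N * 2 * L ^ τ := by gcongr
      _ = 2 * N * L ^ τ * 1 := by ring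
      _ ≤ 2 * N ^ 2 * L ^ τ * (2 * L) ^ rₙ := by
        have : N ≤ N ^ 2 := by nlinarith
        gcongr
  rw [NonSingular, hH]
  refine ⟨isUnit_diagonal_add hη hD hB hε, fun s hs => ?_⟩
  have hs0 : 0 ≤ s := hs₀.trans hs.1
  set z : ℝ := 1 / |g| * Fintype.card (cube L u) * 2 / (L ^ (-τ)) ^ 2 with hz
  refine (sobolevNorm_le hC₀.le hs0 (by positivity : 0 ≤ 2 / L ^ (-τ)) (by positivity : 0 ≤ z) _
    (fun v hv => bracket_le_of_mem_cube_sub hL hv)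
    (fun x => norm_diagonal_add_inv_le hη hD hB hε x x)
    (fun x y hxy => norm_diagonal_add_inv_le_of_ne hη hD hB hε hxy)).trans ?_
  -- The threshold on `|g|` is chosen to make the off-diagonal contribution at most `L^τ`, uniformly
  -- in `s ≤ rₙ`.
  have h1 : ((cube L u).card : ℝ) * z * (2 * L) ^ s ≤ L ^ τ := by
    have h2 : (2 * L) ^ s ≤ (2 * L) ^ rₙ := Real.rpow_le_rpow_of_exponent_le (by linarith) hs.2
    have h3 : ((cube L u).card : ℝ) * z * (2 * L) ^ s =
        L ^ τ * (2 * ((cube L u).card : ℝ) ^ 2 * L ^ τ * (2 * L) ^ s / |g|) := by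
      rw [hz, hηinv, Fintype.card_coe]
      field_simp
    rw [h3]
    refine mul_le_of_le_one_right (by positivity) ((div_le_one hg0).2 (le_trans ?_ hg.le))
    rw [Fintype.card_coe] at hcard
    gcongr
  rw [Real.sqrt_le_left (by positivity)]
  -- The constant `5 = 2² + 1²`, times `C₀`, is absorbed by `L^s`, the square of the gain `L^(s/2)`
  -- that `δ = 1/2` allows.
  calc C₀ * ((2 / L ^ (-τ)) ^ 2 + (((cube L u).card : ℝ) * z * (2 * L) ^ s) ^ 2)
      ≤ C₀ * ((2 * L ^ τ) ^ 2 + (L ^ τ) ^ 2) := by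
        rw [hηinv, div_inv_eq_mul]
        gcongr
    _ = 5 * C₀ * (L ^ τ) ^ 2 := by ring
    _ ≤ L ^ s * (L ^ τ) ^ 2 := by
        gcongr
        exact hLC.trans (Real.rpow_le_rpow_of_exponent_le hL hs.1)
    _ = (L ^ (τ + 1 / 2 * s)) ^ 2 := by
        rw [← Real.rpow_mul_natCast hL0.le, ← Real.rpow_mul_natCast hL0.le, ← Real.rpow_add hL0]
        congr 1
        push_cast
        ring

/-! ### Choice of scale and union bound -/

theorem eventually_card_mul_le {ρ κ p τ : ℝ} {m : ℕ} (hκ : 0 < κ) (h : 2 * p + m < τ * ρ) :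
    ∀ᶠ L : ℝ in Filter.atTop,
      (2 * L + 1) ^ m * (κ⁻¹ * (4 * L ^ (-τ)) ^ ρ) ≤ L ^ (-(2 * p)) := by
  have h0 : 0 < τ * ρ - m - 2 * p := by linarith
  filter_upwards [(tendsto_rpow_atTop h0).eventually_ge_atTop (3 ^ m * κ⁻¹ * 4 ^ ρ),
    Filter.eventually_ge_atTop 1] with L hL hL1
  have hL0 : 0 < L := by linarith
  calc (2 * L + 1) ^ m * (κ⁻¹ * (4 * L ^ (-τ)) ^ ρ)
      ≤ (3 * L) ^ m * (κ⁻¹ * (4 * L ^ (-τ)) ^ ρ) := by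
        gcongr
        linarith
    _ = 3 ^ m * κ⁻¹ * 4 ^ ρ * (L ^ m * L ^ (-τ * ρ)) := by
        rw [Real.mul_rpow (by norm_num) (by positivity), ← Real.rpow_mul hL0.le, mul_pow]
        ring
    _ ≤ L ^ (τ * ρ - m - 2 * p) * (L ^ m * L ^ (-τ * ρ)) := by gcongr
    _ = L ^ (-(2 * p)) := by
        rw [← Real.rpow_natCast L m, ← Real.rpow_add hL0, ← Real.rpow_add hL0]
        congr 1
        ring

end MultiParticle

theorem mainTheorem3
    (n d : ℕ) (hn : 1 ≤ n) (hd : 1 ≤ d)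
    (ρ κ κ₀ p τ s₀ rₙ C₀ : ℝ)
    (hρ : 0 < ρ) (hκ : 0 < κ) (hκ₀ : 0 < κ₀) (hp : 0 < p)
    (hτ : (2 * p + (2 * n + 1) * d) / ρ < τ)
    (hs₀ : (n : ℝ) * d / 2 < s₀) (hrₙ : s₀ ≤ rₙ) (hC₀ : 0 < C₀) :
    ∃ Lstar : ℝ, 0 < Lstar ∧ ∀ L₀ : ℝ, Lstar < L₀ → ∀ M₁ : ℝ,
      ∃ gstar : ℝ, 0 < gstar ∧
        ∀ (r : ℝ), rₙ < r - (n : ℝ) * d / 2 →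
        ∀ (r₀ : ℝ), 1 ≤ r₀ →
        ∀ (U : Site d → Site d → ℝ), IsInteraction U M₁ r₀ →
        ∀ (M : ℝ), 0 < M →
        ∀ (μ : Measure ℝ), μ.support ⊆ Set.Icc (-M) M →
          ENNReal.ofReal κ < holderK ρ μ → HolderUpTo ρ κ κ₀ μ →
        ∀ (Ω : Type*) [MeasurableSpace Ω] (P : Measure Ω) [IsProbabilityMeasure P]
          (V : Site d → Ω → ℝ), IsIIDPotential P V μ →
        ∀ (g : ℝ), gstar < |g| →
        ∀ (u v : Config n d), Separable r₀ L₀ u v →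
          P {ω | ∃ E : ℝ,
              Singular C₀ s₀ rₙ τ r g U (fun x => V x ω) E (1 / 2) L₀ u ∧
              Singular C₀ s₀ rₙ τ r g U (fun x => V x ω) E (1 / 2) L₀ v}
            ≤ ENNReal.ofReal (L₀ ^ (-(2 * p))) := by
  have hnd : 0 ≤ (n : ℝ) * d := by positivity
  have hd' : (1 : ℝ) ≤ d := by exact_mod_cast hd
  have hs0 : 0 < s₀ := by linarith
  have hτ0 : 0 < τ := lt_of_le_of_lt (by positivity) hτ
  -- Counting pairs of points costs only the exponent `2nd`, which is below `(2n+1)d`.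
  have hτρ : 2 * p + ((2 * (n * d) : ℕ) : ℝ) < τ * ρ := by
    rw [div_lt_iff₀ hρ] at hτ
    push_cast
    linarith
  have hlim : Filter.Tendsto (fun L : ℝ => 4 * L ^ (-τ)) Filter.atTop (nhds 0) := by
    simpa using (tendsto_rpow_neg_atTop hτ0).const_mul 4
  obtain ⟨Lstar, hLstar⟩ := Filter.eventually_atTop.1
    ((eventually_card_mul_le hκ hτρ).and (((tendsto_rpow_atTop hs0).eventually_ge_atTop
      (5 * C₀)).and ((hlim.eventually (gt_mem_nhds hκ₀)).and (Filter.eventually_ge_atTop 1))))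
  refine ⟨max Lstar 1, by positivity, fun L hL M₁ => ?_⟩
  obtain ⟨hcard, hLC, hLκ₀, hL1⟩ := hLstar L ((le_max_left _ _).trans hL.le)
  have hL0 : 0 < L := by linarith
  -- No dependence on `M₁`: the interaction merely shifts the diagonal energies deterministically.
  refine ⟨2 * ((2 * L + 1) ^ (n * d)) ^ 2 * L ^ τ * (2 * L) ^ rₙ, by positivity, ?_⟩
  intro r hr r₀ hr₀ U _ M _ μ _ _ hμ Ω _ P _ V hV g hg u v huv
  have hη : 0 < L ^ (-τ) := Real.rpow_pos_of_pos hL0 _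
  set q : ℝ := κ⁻¹ * (4 * L ^ (-τ)) ^ ρ with hqdef
  have hq : ∀ a : ℝ, μ (Set.Icc (a - 2 * L ^ (-τ)) (a + 2 * L ^ (-τ))) ≤ ENNReal.ofReal q := by
    intro a
    refine (hμ _ _ (by linarith) (by linarith)).trans (le_of_eq ?_)
    congr 3
    rw [abs_sub_comm, abs_of_nonneg (by linarith)]
    ring
  set c : Config n d → ℝ := fun x => 1 / g * interaction U x with hc
  set S : Config n d → Config n d → Set Ω := fun x y =>
    {ω | |external (fun a => V a ω) x - external (fun a => V a ω) y + (c x - c y)|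
      < 2 * L ^ (-τ)} with hS
  have hSq : ∀ x ∈ cube L u, ∀ y ∈ cube L v, P (S x y) ≤ ENNReal.ofReal q := by
    intro x hx y hy
    rcases huv.1.exists_ne (by linarith) hx hy with ⟨j₀, h⟩ | ⟨j₀, h⟩
    · exact measure_external_sub_lt_le hV hq h _
    -- The roles of `x` and `y` are exchanged; the energy difference only changes sign.
    · refine le_trans (measure_mono fun ω hω => ?_)
        (measure_external_sub_lt_le hV hq h (c y - c x))
      rw [hS, Set.mem_ofPred_eq, ← abs_neg] at hω
      rw [Set.mem_ofPred_eq]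
      convert hω using 2
      ring
  have hex : ∀ ω E w, Singular C₀ s₀ rₙ τ r g U (fun x => V x ω) E (1 / 2) L w →
      ∃ x ∈ cube L w, |c x + external (fun a => V a ω) x - E| < L ^ (-τ) := by
    intro ω E w hw
    by_contra! hcon
    exact hw (nonSingular_of_le_abs hC₀ hs0.le (by linarith) hτ0.le (by linarith) hL1 hLC hg hcon)
  -- The uncountable union over `E` is replaced by a finite union over pairs of lattice points.
  have hsub : {ω | ∃ E : ℝ, Singular C₀ s₀ rₙ τ r g U (fun x => V x ω) E (1 / 2) L u ∧
      Singular C₀ s₀ rₙ τ r g U (fun x => V x ω) E (1 / 2) L v} ⊆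
      ⋃ z ∈ cube L u ×ˢ cube L v, S z.1 z.2 := by
    rintro ω ⟨E, hu, hv⟩
    obtain ⟨x, hx, hxE⟩ := hex ω E u hu
    obtain ⟨y, hy, hyE⟩ := hex ω E v hv
    refine Set.mem_iUnion₂.2 ⟨(x, y), Finset.mem_product.2 ⟨hx, hy⟩, ?_⟩
    rw [hS, Set.mem_ofPred_eq]
    rw [abs_lt] at hxE hyE ⊢
    constructor <;> linarith [hxE.1, hxE.2, hyE.1, hyE.2]
  have hq0 : 0 ≤ q := by positivity
  refine (measure_mono hsub).trans ((measure_biUnion_finset_le _ _).trans ?_)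
  refine (Finset.sum_le_card_nsmul _ _ (ENNReal.ofReal q) fun z hz => ?_).trans ?_
  · exact hSq _ (Finset.mem_product.1 hz).1 _ (Finset.mem_product.1 hz).2
  · rw [nsmul_eq_mul, ← ENNReal.ofReal_natCast, ← ENNReal.ofReal_mul (Nat.cast_nonneg _)]
    refine ENNReal.ofReal_le_ofReal (le_trans (mul_le_mul_of_nonneg_right ?_ hq0) hcard)
    rw [Finset.card_product, Nat.cast_mul, two_mul (n * d), pow_add]
    exact mul_le_mul (card_cube_le hL0.le u) (card_cube_le hL0.le v) (Nat.cast_nonneg _)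
      (by positivity)
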